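/- **Setting.** A *rooted tree* is a finite tree with a distinguished vertex (the root), all of whose edges are oriented toward the root. A *topological rooted tree* is an isomorphism class of rooted trees. Topological rooted trees are generated recursively by the one-vertex tree $\bullet$ and by $[t_1,\dots,t_m]$ ($m\ge 1$), the tree obtained by grafting the roots of $t_1,\dots,t_m$ to a new root; the order of the $t_i$ is irrelevant. For $p$ in the open upper half plane $\mathcal H\subset\mathbb C$ and $q\in\mathcal H\cup\mathbb R$, $q\neq p$, let $$\phi(p,q)=\frac1{2\pi}\arg\frac{q-p}{q-\bar p}\in[0,1)$$ be the normalized hyperbolic angle at $p$ from the vertical direction to the geodesic from $p$ to $q$, where $\arg$ is taken in $[0,2\pi)$. To a rooted tree $t$ with $n$ vertices, associate the Kontsevich graph $\Gamma_t$ of type $(n,2)$: its aerial vertices are the vertices of $t$, its terrestrial vertices are $\bar 1,\bar 2$, and each aerial vertex $k$ has exactly two ordered outgoing edges. The first edge of $k$ goes to $\bar 1$; the second edge goes to the parent of $k$ in $t$ if $k$ is not the root, and to $\bar 2$ if $k$ is the root. Let $M_n$ be the set of $n$-tuples $z=(z_k)$ of distinct points of $\mathcal H$, oriented by $\bigwedge_k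 dx_k\wedge dy_k$ with $z_k=x_k+iy_k$. Place $\bar1$ at $0$ and $\bar 2$ at $1$, and let $\phi_k^i$ be $\phi(z_k,\cdot)$ evaluated at the position of the end point of the $i$-th edge of $k$. The Kontsevich weight of $t$, in Kathotia's normalization, is $$W_t=W_{\Gamma_t}=\int_{M_n}\bigwedge_{k}d\phi_k^1\wedge d\phi_k^2 ,$$ where $d\phi_k^i$ is the differential of $\phi_k^i$ as a function with values in $\mathbb R/\mathbb Z$. Define functions $I_t$ recursively by $I_\bullet(\theta)=\frac12-\theta$ and $$I_{[t_1,\dots,t_m]}(\theta)=\int_0^1 d\bar\lambda\int_\theta^{\bar\lambda}d\bar\theta\; I_{t_1}(\bar\theta)\cdots I_{t_m}(\bar\theta).$$ **Proposition.** For every rooted tree $t$ the integral defining $W_t$ converges absolutely. Every rooted tree belongs to a topological rooted tree given by a bracket expression as above, and $$W_t=I_t(0),$$ where $I_t$ is computed from any bracket expression of the isomorphism class of $t$. In particular, $W_\bullet=\frac12$, $W_{[\bullet]}=\frac1{12}$, $W_{[\bullet,\bullet]}=\frac1{24}$ and $W_{[[\bullet]]}=0$. -/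

import Mathlib

open MeasureTheory

/-- A rooted tree with vertex set `V`: a directed graph whose edges `v ⟶ w` are those with
`parent v = some w`. All edges are oriented toward the root: every vertex other than the root has
exactly one outgoing edge, the root has none, and from every vertex one arrives at the root by
following the edges. -/
structure RootedTreeOn (V : Type*) where
  root : V
  parent : V → Option V
  parent_eq_none_iff : ∀ v, parent v = none ↔ v = root
  reaches_root : ∀ v, Relation.ReflTransGen (fun a b => parent a = some b) v root

/-- An isomorphism of rooted trees: a bijection of the vertices that respects the edges (and
hence the root, the only vertex without outgoing edge). -/
structure RootedTreeOn.Iso {V V' : Type*} (t : RootedTreeOn V) (t' : RootedTreeOn V')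
    extends V ≃ V' where
  map_parent : ∀ v, t'.parent (toFun v) = (t.parent v).map toFun

theorem RootedTreeOn.parent_ne_self {V : Type*} (t : RootedTreeOn V) (v : V) :
    t.parent v ≠ some v := by
  intro h
  have key : ∀ w, Relation.ReflTransGen (fun a b => t.parent a = some b) v w → w = v := by
    intro w hw
    induction hw with
    | refl => rfl
    | tail _ hbc ih =>
      subst ih
      rw [h] at hbc
      exact (Option.some.inj hbc).symm
  have hr := key _ (t.reaches_root v)
  rw [(t.parent_eq_none_iff v).2 hr.symm] at h
  cases h

/-- The bracket expressions `•` and `[t₁, …, tₘ]` (with `m = k + 1 ≥ 1`) that denote the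
topological rooted trees, i.e. the isomorphism classes of finite rooted trees. -/
inductive BracketTree : Type
  | bullet : BracketTree
  | graft (k : ℕ) (ts : Fin (k + 1) → BracketTree) : BracketTree

namespace BracketTree

/-- The vertices of the tree denoted by a bracket expression; `none` is the root of a graft. -/
def Vert : BracketTree → Type
  | bullet => Unit
  | graft k ts => Option (Σ i : Fin (k + 1), Vert (ts i))

instance instFintypeVert : (e : BracketTree) → Fintype e.Vert
  | bullet => inferInstanceAs (Fintype Unit)
  | graft k ts =>
    letI : ∀ i, Fintype (ts i).Vert := fun i => instFintypeVert (ts i)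
    inferInstanceAs (Fintype (Option (Σ i : Fin (k + 1), (ts i).Vert)))

instance instDecidableEqVert : (e : BracketTree) → DecidableEq e.Vert
  | bullet => inferInstanceAs (DecidableEq Unit)
  | graft k ts =>
    letI : ∀ i, DecidableEq (ts i).Vert := fun i => instDecidableEqVert (ts i)
    inferInstanceAs (DecidableEq (Option (Σ i : Fin (k + 1), (ts i).Vert)))

end BracketTree

/-- The one-vertex rooted tree. -/
def RootedTreeOn.single : RootedTreeOn Unit where
  root := ()
  parent _ := none
  parent_eq_none_iff _ := by simp
  reaches_root _ := Relation.ReflTransGen.refl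

/-- Grafting the roots of the trees `ts i` to a new root `none`. -/
def RootedTreeOn.graft {ι : Type*} {V : ι → Type*} (ts : ∀ i, RootedTreeOn (V i)) :
    RootedTreeOn (Option (Σ i, V i)) where
  root := none
  parent
    | none => none
    | some ⟨i, v⟩ => some (((ts i).parent v).map (Sigma.mk i))
  parent_eq_none_iff v := by
    rcases v with _ | ⟨i, v⟩ <;> simp
  reaches_root v := by
    rcases v with _ | ⟨i, v⟩
    · exact Relation.ReflTransGen.refl
    · refine Relation.ReflTransGen.tail (b := some ⟨i, (ts i).root⟩) ?_ ?_
      · refine Relation.ReflTransGen.lift (fun w => (some ⟨i, w⟩ : Option (Σ i, V i)))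
          (fun a b h => ?_) _ _ ((ts i).reaches_root v)
        simp only [Function.onFun, h, Option.map_some]
      · simp [((ts i).parent_eq_none_iff _).2 rfl]

/-- The rooted tree denoted by a bracket expression. -/
def BracketTree.toRootedTree : (e : BracketTree) → RootedTreeOn e.Vert
  | .bullet => RootedTreeOn.single
  | .graft _ ts => RootedTreeOn.graft fun i => (ts i).toRootedTree

/-- The functions `I_t`:
`I_•(θ) = 1/2 - θ` and `I_[t₁,…,tₘ](θ) = ∫₀¹ dlam ∫_θ^lam ds I_{t₁}(s) ⋯ I_{tₘ}(s)`. -/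
noncomputable def BracketTree.I : BracketTree → ℝ → ℝ
  | .bullet => fun θ => 1 / 2 - θ
  | .graft _ ts => fun θ => ∫ lam in (0 : ℝ)..1, ∫ s in θ..lam, ∏ i, (ts i).I s

/-- A Kontsevich graph with set `V` of aerial vertices and terrestrial vertices `Fin m`
(`0`, `1`, … standing for the first, the second, …): every aerial vertex has a first and a second
outgoing edge (`target k 0` and `target k 1` are their end points), there are no other edges, and
loops are not allowed. -/
structure KontsevichGraph (V : Type*) (m : ℕ) where
  target : V → Fin 2 → V ⊕ Fin m
  no_loop : ∀ k i, target k i ≠ Sum.inl k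

/-- The Kontsevich tree `Γ_t`: its interior is `t`, all terrestrial edges land on the first
terrestrial vertex and are first edges, except that the second edge of the root lands on
the second terrestrial vertex. -/
def RootedTreeOn.kontsevichTree {V : Type*} (t : RootedTreeOn V) : KontsevichGraph V 2 where
  target k i :=
    if i = 0 then Sum.inr 0
    else
      match t.parent k with
      | some w => Sum.inl w
      | none => Sum.inr 1
  no_loop k i := by
    have h := t.parent_ne_self k
    split_ifs
    · simp
    · cases hk : t.parent k with
      | none => simp
      | some w => rw [hk] at h; simpa using h

/-- The angle function with values in `[0, 1)`: the hyperbolic angle at `p`, counterclockwise and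
divided by `2π`, from the vertical line through `p` to the geodesic from `p` to `q`. -/
noncomputable def angle (p q : ℂ) : ℝ :=
  Int.fract (Complex.arg ((q - p) / (q - (starRingEnd ℂ) p)) / (2 * Real.pi))

/-- The configuration space: tuples of distinct points of the open upper half plane. -/
def configSpace (V : Type*) : Set (V → ℂ) :=
  {z | (∀ k, 0 < (z k).im) ∧ Function.Injective z}

namespace KontsevichGraph

variable {V : Type*}

/-- The position of a vertex in a configuration: the two terrestrial vertices sit at `0`, `1`. -/
def position (z : V → ℂ) : V ⊕ Fin 2 → ℂ
  | Sum.inl k => z k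
  | Sum.inr j => ![0, 1] j

/-- The angle function of the `i`-th edge of `k`. -/
noncomputable def edgeAngle (Γ : KontsevichGraph V 2) (k : V) (i : Fin 2) (z : V → ℂ) : ℝ :=
  angle (z k) (position z (Γ.target k i))

variable [Fintype V] [DecidableEq V]

/-- The density of the angle form `⋀ₖ dφₖ¹ ∧ dφₖ²` with respect to the volume form
`⋀ₖ dxₖ ∧ dyₖ`, where `zₖ = xₖ + i yₖ`: the Jacobian determinant of the `2n` angle functions.
(An angle jumps from `1` to `0` where `p` lies vertically below `q`; this set of configurations
is a null set.) -/
noncomputable def angleFormDensity (Γ : KontsevichGraph V 2) (z : V → ℂ) : ℝ :=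
  Matrix.det (Matrix.of fun (a b : V × Fin 2) =>
    fderiv ℝ (Γ.edgeAngle a.1 a.2) z (Pi.single b.1 (![1, Complex.I] b.2)))

/-- The Kontsevich weight, the integral of the angle form over the configuration space (the
boundary of its compactification does not contribute). Neither a factor `1 / n!` nor powers
of `2π` occur, as the angles are in `[0, 1)`. -/
noncomputable def weight (Γ : KontsevichGraph V 2) : ℝ :=
  ∫ z in configSpace V, Γ.angleFormDensity z

end KontsevichGraph

/-- The Kontsevich weight `W_t` of a rooted tree. -/
noncomputable def RootedTreeOn.weight {V : Type*} [Fintype V] [DecidableEq V]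
    (t : RootedTreeOn V) : ℝ :=
  t.kontsevichTree.weight

namespace RootedTreeOn

variable {V : Type*}

theorem wellFounded_parent (t : RootedTreeOn V) :
    WellFounded fun a b => t.parent b = some a := by
  refine ⟨fun v => ?_⟩
  induction t.reaches_root v using Relation.ReflTransGen.head_induction_on with
  | refl =>
    refine ⟨_, fun y hy => ?_⟩
    rw [(t.parent_eq_none_iff _).2 rfl] at hy
    cases hy
  | head h _ ih =>
    refine ⟨_, fun y hy => ?_⟩
    rw [h] at hy
    cases hy
    exact ih

/-- A numbering of the vertices by depth. -/
theorem exists_depth (t : RootedTreeOn V) :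
    ∃ d : V → ℕ, ∀ v w, t.parent v = some w → d w < d v := by
  classical
  refine ⟨t.wellFounded_parent.fix fun v d =>
    if h : ∃ w, t.parent v = some w then d h.choose h.choose_spec + 1 else 0, fun v w hw => ?_⟩
  conv_rhs => rw [WellFounded.fix_eq]
  have h : ∃ w, t.parent v = some w := ⟨w, hw⟩
  rw [dif_pos h]
  obtain rfl : w = h.choose := Option.some.inj (hw.symm.trans h.choose_spec)
  exact Nat.lt_succ_self _

theorem reaches_antisymm (t : RootedTreeOn V) {a b : V}
    (h : Relation.ReflTransGen (fun a b => t.parent a = some b) a b)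
    (h' : t.parent b = some a) : False := by
  obtain ⟨d, hd⟩ := t.exists_depth
  have key : d b ≤ d a := by
    clear h'
    induction h with
    | refl => rfl
    | tail _ h ih => exact (hd _ _ h).le.trans ih
  exact absurd (hd _ _ h') (not_lt.2 key)

/-- Two ancestors of a vertex are comparable. -/
theorem reaches_total (t : RootedTreeOn V) {x a b : V}
    (ha : Relation.ReflTransGen (fun a b => t.parent a = some b) x a)
    (hb : Relation.ReflTransGen (fun a b => t.parent a = some b) x b) :
    Relation.ReflTransGen (fun a b => t.parent a = some b) a b ∨
      Relation.ReflTransGen (fun a b => t.parent a = some b) b a :=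
  Relation.ReflTransGen.total_of_right_unique
    (fun _ _ _ h h' => Option.some.inj (h.symm.trans h')) ha hb

/-- The vertices below siblings are distinct. -/
theorem eq_of_reaches_sibling (t : RootedTreeOn V) {x a b v : V}
    (ha : Relation.ReflTransGen (fun a b => t.parent a = some b) x a)
    (hb : Relation.ReflTransGen (fun a b => t.parent a = some b) x b)
    (hav : t.parent a = some v) (hbv : t.parent b = some v) : a = b := by
  have key : ∀ {a b}, t.parent a = some v → t.parent b = some v →
      Relation.ReflTransGen (fun a b => t.parent a = some b) a b → a = b := by
    intro a b ha hb h
    rcases Relation.ReflTransGen.cases_head h with h | ⟨c, hc, hcb⟩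
    · exact h
    · rw [ha] at hc
      cases hc
      exact (t.reaches_antisymm hcb hb).elim
  rcases t.reaches_total ha hb with h | h
  · exact key hav hbv h
  · exact (key hbv hav h).symm

/-- The part of a finite rooted tree below a vertex is denoted by a bracket expression. -/
theorem exists_bracketTree_below [Finite V] (t : RootedTreeOn V) (v : V) :
    ∃ (e : BracketTree) (f : e.Vert → V), Function.Injective f ∧
      Set.range f = {x | Relation.ReflTransGen (fun a b => t.parent a = some b) x v} ∧
      f e.toRootedTree.root = v ∧
      ∀ x y, e.toRootedTree.parent x = some y → t.parent (f x) = some (f y) := by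
  obtain ⟨d, hd⟩ := t.exists_depth
  obtain ⟨N, hN⟩ := (Set.finite_range d).bddAbove
  have hN' : ∀ v, d v ≤ N := fun v => hN ⟨v, rfl⟩
  induction hn : N - d v using Nat.strong_induction_on generalizing v with
  | _ n ih =>
  classical
  have := Fintype.ofFinite V
  by_cases hc : IsEmpty {c // t.parent c = some v}
  · refine ⟨.bullet, fun _ => v, fun _ _ _ => rfl, ?_, rfl, ?_⟩
    · ext x
      constructor
      · rintro ⟨_, rfl⟩
        exact Relation.ReflTransGen.refl
      · intro hx
        rcases Relation.ReflTransGen.cases_tail hx with h | ⟨c, _, h⟩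
        · exact ⟨(), h⟩
        · exact (hc.false ⟨c, h⟩).elim
    · intro x y h
      cases h
  · rw [not_isEmpty_iff] at hc
    obtain ⟨k, hk⟩ : ∃ k, Fintype.card {c // t.parent c = some v} = k + 1 :=
      Nat.exists_eq_succ_of_ne_zero Fintype.card_ne_zero
    let c := (Fintype.equivFinOfCardEq hk).symm
    have hrec : ∀ i, ∃ (e : BracketTree) (f : e.Vert → V), Function.Injective f ∧
        Set.range f =
          {x | Relation.ReflTransGen (fun a b => t.parent a = some b) x (c i).1} ∧
        f e.toRootedTree.root = (c i).1 ∧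
        ∀ x y, e.toRootedTree.parent x = some y → t.parent (f x) = some (f y) := by
      intro i
      refine ih (N - d (c i).1) ?_ _ rfl
      have h1 := hd _ _ (c i).2
      have h2 := hN' (c i).1
      omega
    choose e f hinj hrange hroot hpar using hrec
    have hmem : ∀ i x, Relation.ReflTransGen (fun a b => t.parent a = some b) (f i x) (c i).1 :=
      fun i x => (hrange i).subset ⟨x, rfl⟩
    refine ⟨.graft k e, fun o : Option (Σ i, (e i).Vert) => o.elim v fun s => f s.1 s.2,
      ?_, ?_, rfl, ?_⟩
    · rintro (_ | ⟨i, x⟩) (_ | ⟨j, y⟩) h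
      · rfl
      · have h' : f j y = v := h.symm
        exact (t.reaches_antisymm (h' ▸ hmem j y) (c j).2).elim
      · have h' : f i x = v := h
        exact (t.reaches_antisymm (h' ▸ hmem i x) (c i).2).elim
      · have h' : f i x = f j y := h
        have hij : i = j := c.injective (Subtype.ext
          (t.eq_of_reaches_sibling (hmem i x) (h' ▸ hmem j y) (c i).2 (c j).2))
        subst hij
        rw [hinj i h']
    · ext x
      constructor
      · rintro ⟨_ | ⟨i, y⟩, rfl⟩
        · exact Relation.ReflTransGen.refl
        · exact (hmem i y).tail (c i).2
      · intro hx
        rcases Relation.ReflTransGen.cases_tail hx with h | ⟨b, hb, h⟩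
        · exact ⟨none, h⟩
        · obtain ⟨i, hi⟩ := c.surjective ⟨b, h⟩
          have : x ∈ Set.range (f i) := by
            rw [hrange, hi]
            exact hb
          obtain ⟨y, hy⟩ := this
          exact ⟨some ⟨i, y⟩, hy⟩
    · rintro (_ | ⟨i, x⟩) y h
      · cases h
      · have h' : some (((e i).toRootedTree.parent x).map (Sigma.mk i)) = some y := h
        cases h'
        change t.parent (f i x) = _
        cases hp : (e i).toRootedTree.parent x with
        | none =>
          rw [(RootedTreeOn.parent_eq_none_iff _ _).1 hp, hroot]
          exact (c i).2
        | some w => exact hpar i x w hp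

theorem exists_iso_bracketTree [Finite V] (t : RootedTreeOn V) :
    ∃ e : BracketTree, Nonempty (t.Iso e.toRootedTree) := by
  obtain ⟨e, f, hinj, hrange, hroot, hpar⟩ := t.exists_bracketTree_below t.root
  have hsurj : Function.Surjective f := fun x => by
    have : x ∈ Set.range f := hrange.symm.subset (t.reaches_root x)
    exact this
  let σ := Equiv.ofBijective f ⟨hinj, hsurj⟩
  refine ⟨e, ⟨⟨σ.symm, fun v => ?_⟩⟩⟩
  obtain ⟨x, rfl⟩ := hsurj v
  have hx : σ.symm (f x) = x := σ.symm_apply_apply x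
  change e.toRootedTree.parent (σ.symm (f x)) = (t.parent (f x)).map σ.symm
  rw [hx]
  cases hp : e.toRootedTree.parent x with
  | none =>
    rw [(RootedTreeOn.parent_eq_none_iff _ _).1 hp, hroot, (t.parent_eq_none_iff _).2 rfl]
    rfl
  | some y =>
    rw [hpar x y hp]
    exact congrArg some (σ.symm_apply_apply y).symm

end RootedTreeOn

/-- The Poisson-type kernel `ρ sin δ / |r - ρ e^{iδ}|²`. -/
noncomputable def rayKernel (ρ δ r : ℝ) : ℝ :=
  ρ * Real.sin δ / (r ^ 2 + ρ ^ 2 - 2 * r * ρ * Real.cos δ)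

theorem rayKernel_two_pi_sub (ρ δ r : ℝ) :
    rayKernel ρ (2 * Real.pi - δ) r = -rayKernel ρ δ r := by
  simp [rayKernel, Real.sin_two_pi_sub, Real.cos_two_pi_sub, neg_div]

theorem hasDerivAt_arctan_rayKernel {ρ δ : ℝ} (hρ : 0 < ρ) (hs : 0 < Real.sin δ) (r : ℝ) :
    HasDerivAt (fun r => Real.arctan ((r - ρ * Real.cos δ) / (ρ * Real.sin δ)))
      (rayKernel ρ δ r) r := by
  have h1 : HasDerivAt (fun r => (r - ρ * Real.cos δ) / (ρ * Real.sin δ))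
      (1 / (ρ * Real.sin δ)) r :=
    ((hasDerivAt_id r).sub_const _).div_const _
  convert h1.arctan using 1
  have h2 : r ^ 2 + ρ ^ 2 - 2 * r * ρ * Real.cos δ
      = (r - ρ * Real.cos δ) ^ 2 + (ρ * Real.sin δ) ^ 2 := by
    have := Real.sin_sq_add_cos_sq δ
    linear_combination (-ρ ^ 2) * this
  have h3 : 0 < (r - ρ * Real.cos δ) ^ 2 + (ρ * Real.sin δ) ^ 2 := by positivity
  rw [rayKernel, h2]
  have h4 : 1 + ((r - ρ * Real.cos δ) / (ρ * Real.sin δ)) ^ 2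
      = ((r - ρ * Real.cos δ) ^ 2 + (ρ * Real.sin δ) ^ 2) / (ρ * Real.sin δ) ^ 2 := by
    field_simp
    ring
  rw [h4]
  have h5 : ρ * Real.sin δ ≠ 0 := by positivity
  generalize ρ * Real.sin δ = a at *
  field_simp

theorem rayKernel_nonneg {ρ δ : ℝ} (hρ : 0 < ρ) (hs : 0 < Real.sin δ) (r : ℝ) :
    0 ≤ rayKernel ρ δ r := by
  have h2 : r ^ 2 + ρ ^ 2 - 2 * r * ρ * Real.cos δ
      = (r - ρ * Real.cos δ) ^ 2 + (ρ * Real.sin δ) ^ 2 := by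
    have := Real.sin_sq_add_cos_sq δ
    linear_combination (-ρ ^ 2) * this
  rw [rayKernel, h2]
  positivity

theorem tendsto_arctan_rayKernel {ρ δ : ℝ} (hρ : 0 < ρ) (hs : 0 < Real.sin δ) :
    Filter.Tendsto (fun r => Real.arctan ((r - ρ * Real.cos δ) / (ρ * Real.sin δ))) Filter.atTop
      (nhds (Real.pi / 2)) := by
  have h : Filter.Tendsto (fun r => (r - ρ * Real.cos δ) / (ρ * Real.sin δ)) Filter.atTop
      Filter.atTop :=
    (Filter.tendsto_atTop_add_const_right _ _ Filter.tendsto_id).atTop_div_const (by positivity)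
  exact (tendsto_nhds_of_tendsto_nhdsWithin Real.tendsto_arctan_atTop).comp h

theorem integrableOn_rayKernel_of_lt_pi {ρ δ : ℝ} (hρ : 0 < ρ) (h0 : 0 < δ) (h1 : δ < Real.pi) :
    IntegrableOn (rayKernel ρ δ) (Set.Ioi 0) :=
  have hs := Real.sin_pos_of_pos_of_lt_pi h0 h1
  integrableOn_Ioi_deriv_of_nonneg' (fun x _ => hasDerivAt_arctan_rayKernel hρ hs x)
    (fun x _ => rayKernel_nonneg hρ hs x) (tendsto_arctan_rayKernel hρ hs)

theorem integral_rayKernel_of_lt_pi {ρ δ : ℝ} (hρ : 0 < ρ) (h0 : 0 < δ) (h1 : δ < Real.pi) :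
    ∫ r in Set.Ioi 0, rayKernel ρ δ r = Real.pi - δ := by
  have hs := Real.sin_pos_of_pos_of_lt_pi h0 h1
  rw [integral_Ioi_of_hasDerivAt_of_nonneg' (fun x _ => hasDerivAt_arctan_rayKernel hρ hs x)
    (fun x _ => rayKernel_nonneg hρ hs x) (tendsto_arctan_rayKernel hρ hs)]
  have h2 : (0 - ρ * Real.cos δ) / (ρ * Real.sin δ) = Real.tan (δ - Real.pi / 2) := by
    rw [Real.tan_eq_sin_div_cos, Real.sin_sub_pi_div_two, Real.cos_sub_pi_div_two]
    field_simp
    ring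
  rw [h2, Real.arctan_tan (by linarith) (by linarith)]
  ring

theorem rayKernel_zero_of_sin {ρ δ : ℝ} (h : Real.sin δ = 0) : rayKernel ρ δ = 0 := by
  ext r
  simp [rayKernel, h]

/-- The integral of the kernel over a ray, for `0 < δ < 2π`. -/
theorem integrableOn_rayKernel {ρ δ : ℝ} (hρ : 0 < ρ) (h0 : 0 < δ) (h1 : δ < 2 * Real.pi) :
    IntegrableOn (rayKernel ρ δ) (Set.Ioi 0) ∧
      ∫ r in Set.Ioi 0, rayKernel ρ δ r = Real.pi - δ ∧
      ∫ r in Set.Ioi 0, |rayKernel ρ δ r| ≤ Real.pi := by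
  have key : ∀ δ, 0 < δ → δ < Real.pi → ∫ r in Set.Ioi 0, |rayKernel ρ δ r| ≤ Real.pi := by
    intro δ h0 h1
    have hs := Real.sin_pos_of_pos_of_lt_pi h0 h1
    simp_rw [abs_of_nonneg (rayKernel_nonneg hρ hs _)]
    rw [integral_rayKernel_of_lt_pi hρ h0 h1]
    linarith
  rcases lt_trichotomy δ Real.pi with h | h | h
  · exact ⟨integrableOn_rayKernel_of_lt_pi hρ h0 h, integral_rayKernel_of_lt_pi hρ h0 h,
      key δ h0 h⟩
  · have hz : rayKernel ρ δ = 0 := rayKernel_zero_of_sin (by simp [h])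
    rw [hz]
    refine ⟨integrableOn_zero, by simp [h], by simp [Real.pi_pos.le]⟩
  · have e : rayKernel ρ δ = fun r => -rayKernel ρ (2 * Real.pi - δ) r := by
      ext r
      rw [rayKernel_two_pi_sub, neg_neg]
    have ha : 0 < 2 * Real.pi - δ := by linarith
    have hb : 2 * Real.pi - δ < Real.pi := by linarith
    rw [e]
    refine ⟨(integrableOn_rayKernel_of_lt_pi hρ ha hb).neg, ?_, ?_⟩
    · rw [integral_neg, integral_rayKernel_of_lt_pi hρ ha hb]
      ring
    · simp_rw [abs_neg]
      exact key _ ha hb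

theorem rayKernel_add_two_pi (ρ δ r : ℝ) :
    rayKernel ρ (δ + 2 * Real.pi) r = rayKernel ρ δ r := by
  simp [rayKernel]

/-- The radial density of the angle form in polar coordinates, for an end point of modulus `ρ`
and argument `τ`. -/
noncomputable def polarKernel (ρ τ : ℝ) (p : ℝ × ℝ) : ℝ :=
  1 / (2 * Real.pi ^ 2) * (rayKernel ρ (p.2 - τ) p.1 + rayKernel ρ (p.2 + τ) p.1)

theorem measurable_polarKernel (ρ τ : ℝ) : Measurable (polarKernel ρ τ) := by
  unfold polarKernel rayKernel
  fun_prop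

theorem integrableOn_polarKernel_ray {ρ τ α : ℝ} (hρ : 0 < ρ) (h0 : 0 ≤ τ) (h1 : τ < Real.pi)
    (ha : 0 < α) (hb : α < Real.pi) (hne : α ≠ τ) :
    IntegrableOn (fun r => polarKernel ρ τ (r, α)) (Set.Ioi 0) ∧
      ∫ r in Set.Ioi 0, polarKernel ρ τ (r, α)
        = 1 / Real.pi * ((if τ < α then 1 else 0) - α / Real.pi) ∧
      ∫ r in Set.Ioi 0, |polarKernel ρ τ (r, α)| ≤ 1 / Real.pi := by
  have hpi := Real.pi_pos
  obtain ⟨i2, e2, b2⟩ := integrableOn_rayKernel (δ := α + τ) hρ (by linarith) (by linarith)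
  have h : IntegrableOn (rayKernel ρ (α - τ)) (Set.Ioi 0) ∧
      ∫ r in Set.Ioi 0, rayKernel ρ (α - τ) r
        = (if τ < α then 2 * Real.pi else 0) - Real.pi - (α - τ) ∧
      ∫ r in Set.Ioi 0, |rayKernel ρ (α - τ) r| ≤ Real.pi := by
    split_ifs with hlt
    · obtain ⟨i, e, b⟩ := integrableOn_rayKernel (δ := α - τ) hρ (by linarith) (by linarith)
      exact ⟨i, by rw [e]; ring, b⟩
    · have hlt' : α < τ := lt_of_le_of_ne (not_lt.1 hlt) hne
      have he : rayKernel ρ (α - τ) = rayKernel ρ (α - τ + 2 * Real.pi) := by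
        ext r; rw [rayKernel_add_two_pi]
      obtain ⟨i, e, b⟩ := integrableOn_rayKernel (δ := α - τ + 2 * Real.pi) hρ (by linarith)
        (by linarith)
      rw [he]
      exact ⟨i, by rw [e]; ring, b⟩
  obtain ⟨i1, e1, b1⟩ := h
  refine ⟨(i1.add i2).const_mul _, ?_, ?_⟩
  · simp only [polarKernel]
    rw [integral_const_mul, integral_add i1 i2, e1, e2]
    split_ifs <;> field_simp <;> ring
  · calc ∫ r in Set.Ioi 0, |polarKernel ρ τ (r, α)|
        ≤ ∫ r in Set.Ioi 0, 1 / (2 * Real.pi ^ 2) *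
          (|rayKernel ρ (α - τ) r| + |rayKernel ρ (α + τ) r|) := by
          refine integral_mono ((i1.add i2).const_mul _).abs
            ((i1.abs.add i2.abs).const_mul _) fun r => ?_
          simp only [polarKernel]
          rw [abs_mul, abs_of_nonneg (by positivity)]
          gcongr
          exact abs_add_le _ _
      _ ≤ 1 / (2 * Real.pi ^ 2) * (Real.pi + Real.pi) := by
          rw [integral_const_mul, integral_add i1.abs i2.abs]
          gcongr
      _ = 1 / Real.pi := by field_simp; ring

theorem lintegral_polarKernel_le {ρ τ : ℝ} (hρ : 0 < ρ) (h0 : 0 ≤ τ) (h1 : τ < Real.pi) :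
    ∫⁻ p in Set.Ioi (0 : ℝ) ×ˢ Set.Ioo 0 Real.pi, ‖polarKernel ρ τ p‖ₑ ≤ 1 := by
  rw [Measure.volume_eq_prod, ← Measure.prod_restrict, lintegral_prod_symm' _
    (measurable_polarKernel ρ τ).enorm]
  calc ∫⁻ α in Set.Ioo 0 Real.pi, ∫⁻ r in Set.Ioi 0, ‖polarKernel ρ τ (r, α)‖ₑ
      ≤ ∫⁻ α in Set.Ioo 0 Real.pi, ENNReal.ofReal (1 / Real.pi) := by
        refine lintegral_mono_ae ?_
        have hne : ∀ᵐ α ∂(volume.restrict (Set.Ioo 0 Real.pi)), α ≠ τ :=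
          ae_restrict_of_ae (Measure.ae_ne volume τ)
        filter_upwards [hne, ae_restrict_mem measurableSet_Ioo] with α hα hm
        obtain ⟨i, -, b⟩ := integrableOn_polarKernel_ray hρ h0 h1 hm.1 hm.2 hα
        rw [← ofReal_integral_norm_eq_lintegral_enorm i]
        exact ENNReal.ofReal_le_ofReal b
    _ = 1 := by
        rw [setLIntegral_const, Real.volume_Ioo, ← ENNReal.ofReal_mul (by positivity)]
        have := Real.pi_pos
        simp [this.ne']

/-- The open upper half plane. -/
def upperHalf : Set ℂ := {z | 0 < z.im}

theorem measurableSet_upperHalf : MeasurableSet upperHalf :=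
  measurableSet_lt measurable_const Complex.measurable_im

theorem polarCoord_symm_mem_upperHalf {p : ℝ × ℝ} (hp : p ∈ Complex.polarCoord.target) :
    Complex.polarCoord.symm p ∈ upperHalf ↔ p ∈ Set.Ioi (0 : ℝ) ×ˢ Set.Ioo 0 Real.pi := by
  rw [Complex.polarCoord_target] at hp
  obtain ⟨hr, ha, hb⟩ := hp
  have hr' : 0 < p.1 := hr
  have him : (Complex.polarCoord.symm p).im = p.1 * Real.sin p.2 := by
    simp [-Complex.ofReal_cos, -Complex.ofReal_sin]
  simp only [upperHalf, Set.mem_ofPred_eq, him, Set.mem_prod, Set.mem_Ioi, Set.mem_Ioo]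
  constructor
  · intro h
    refine ⟨hr, ?_, hb⟩
    by_contra hneg
    have := Real.sin_nonpos_of_nonpos_of_neg_pi_le (not_lt.1 hneg) ha.le
    nlinarith
  · rintro ⟨-, h1, h2⟩
    exact mul_pos hr' (Real.sin_pos_of_pos_of_lt_pi h1 h2)

theorem polar_upperHalf_subset :
    Set.Ioi (0 : ℝ) ×ˢ Set.Ioo 0 Real.pi ⊆ Complex.polarCoord.target := by
  rw [Complex.polarCoord_target]
  exact Set.prod_mono le_rfl (Set.Ioo_subset_Ioo_left (by linarith [Real.pi_pos]))

theorem integral_upperHalf_eq_polar (f : ℂ → ℝ) :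
    ∫ z in upperHalf, f z = ∫ p in Set.Ioi (0 : ℝ) ×ˢ Set.Ioo 0 Real.pi,
      p.1 * f (Complex.polarCoord.symm p) := by
  have hm : MeasurableSet (Set.Ioi (0 : ℝ) ×ˢ Set.Ioo 0 Real.pi) :=
    measurableSet_Ioi.prod measurableSet_Ioo
  rw [← integral_indicator measurableSet_upperHalf, ← Complex.integral_comp_polarCoord_symm]
  have hsub := polar_upperHalf_subset
  rw [← Set.inter_eq_self_of_subset_right hsub, ← setIntegral_indicator hm]
  refine setIntegral_congr_fun Complex.polarCoord.open_target.measurableSet fun p hp => ?_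
  have h := polarCoord_symm_mem_upperHalf hp
  by_cases h' : p ∈ Set.Ioi (0 : ℝ) ×ˢ Set.Ioo 0 Real.pi
  · simp only [Set.indicator_of_mem h', Set.indicator_of_mem (h.2 h'), smul_eq_mul]
  · simp only [Set.indicator_of_notMem h', Set.indicator_of_notMem (mt h.1 h'), smul_zero]

theorem lintegral_upperHalf_eq_polar (f : ℂ → ENNReal) :
    ∫⁻ z in upperHalf, f z = ∫⁻ p in Set.Ioi (0 : ℝ) ×ˢ Set.Ioo 0 Real.pi,
      ENNReal.ofReal p.1 * f (Complex.polarCoord.symm p) := by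
  have hm : MeasurableSet (Set.Ioi (0 : ℝ) ×ˢ Set.Ioo 0 Real.pi) :=
    measurableSet_Ioi.prod measurableSet_Ioo
  rw [← lintegral_indicator measurableSet_upperHalf, ← Complex.lintegral_comp_polarCoord_symm]
  have hsub := polar_upperHalf_subset
  rw [← Set.inter_eq_self_of_subset_left hsub, ← setLIntegral_indicator hm]
  refine setLIntegral_congr_fun Complex.polarCoord.open_target.measurableSet fun p hp => ?_
  have h := polarCoord_symm_mem_upperHalf hp
  by_cases h' : p ∈ Set.Ioi (0 : ℝ) ×ˢ Set.Ioo 0 Real.pi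
  · simp only [Set.indicator_of_mem h', Set.indicator_of_mem (h.2 h'), smul_eq_mul]
  · simp only [Set.indicator_of_notMem h', Set.indicator_of_notMem (mt h.1 h'), smul_zero]

/-- The density of `dφ(z, 0) ∧ dφ(z, q)` in the variable `z`. -/
noncomputable def angleKernel (z q : ℂ) : ℝ :=
  1 / (2 * Real.pi ^ 2) *
    ((z.im * q.re - z.re * q.im) / (Complex.normSq z * Complex.normSq (z - q)) +
      (z.im * q.re + z.re * q.im) / (Complex.normSq z * Complex.normSq (z - (starRingEnd ℂ) q)))

theorem measurable_angleKernel : Measurable fun p : ℂ × ℂ => angleKernel p.1 p.2 := by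
  have h1 : Measurable Complex.normSq := Complex.continuous_normSq.measurable
  have h2 : Measurable (starRingEnd ℂ) := Complex.continuous_conj.measurable
  unfold angleKernel
  fun_prop

theorem mul_angleKernel_polar {q : ℂ} {p : ℝ × ℝ} (hp : 0 < p.1) :
    p.1 * angleKernel (Complex.polarCoord.symm p) q = polarKernel ‖q‖ q.arg p := by
  obtain ⟨r, α⟩ := p
  simp only at hp
  have hre : (Complex.polarCoord.symm (r, α)).re = r * Real.cos α := by
    simp [-Complex.ofReal_cos, -Complex.ofReal_sin]
  have him : (Complex.polarCoord.symm (r, α)).im = r * Real.sin α := by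
    simp [-Complex.ofReal_cos, -Complex.ofReal_sin]
  have hqre : q.re = ‖q‖ * Real.cos q.arg := by rw [Complex.norm_mul_cos_arg]
  have hqim : q.im = ‖q‖ * Real.sin q.arg := by rw [Complex.norm_mul_sin_arg]
  simp only [angleKernel, polarKernel, rayKernel, Complex.normSq_apply, Complex.sub_re,
    Complex.sub_im, Complex.conj_re, Complex.conj_im, hre, him]
  generalize ‖q‖ = ρ at *
  generalize q.arg = τ at *
  rw [hqre, hqim, Real.sin_sub, Real.sin_add, Real.cos_sub, Real.cos_add]
  have h1 := Real.sin_sq_add_cos_sq α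
  have h2 := Real.sin_sq_add_cos_sq τ
  have e0 : r * Real.cos α * (r * Real.cos α) + r * Real.sin α * (r * Real.sin α) = r ^ 2 := by
    linear_combination r ^ 2 * h1
  have e1 : (r * Real.cos α - ρ * Real.cos τ) * (r * Real.cos α - ρ * Real.cos τ) +
      (r * Real.sin α - ρ * Real.sin τ) * (r * Real.sin α - ρ * Real.sin τ) =
      r ^ 2 + ρ ^ 2 - 2 * r * ρ * (Real.cos α * Real.cos τ + Real.sin α * Real.sin τ) := by
    linear_combination r ^ 2 * h1 + ρ ^ 2 * h2
  have e2 : (r * Real.cos α - ρ * Real.cos τ) * (r * Real.cos α - ρ * Real.cos τ) +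
      (r * Real.sin α - -(ρ * Real.sin τ)) * (r * Real.sin α - -(ρ * Real.sin τ)) =
      r ^ 2 + ρ ^ 2 - 2 * r * ρ * (Real.cos α * Real.cos τ - Real.sin α * Real.sin τ) := by
    linear_combination r ^ 2 * h1 + ρ ^ 2 * h2
  rw [e0, e1, e2]
  generalize r ^ 2 + ρ ^ 2 - 2 * r * ρ * (Real.cos α * Real.cos τ + Real.sin α * Real.sin τ) = A
  generalize r ^ 2 + ρ ^ 2 - 2 * r * ρ * (Real.cos α * Real.cos τ - Real.sin α * Real.sin τ) = B
  have hcancel : ∀ x y : ℝ, r * x / (r ^ 2 * y) = r⁻¹ * (x / y) := by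
    intro x y
    rw [mul_div_mul_comm]
    congr 1
    field_simp
  have f1 : r * Real.sin α * (ρ * Real.cos τ) - r * Real.cos α * (ρ * Real.sin τ)
      = r * (ρ * (Real.sin α * Real.cos τ - Real.cos α * Real.sin τ)) := by ring
  have f2 : r * Real.sin α * (ρ * Real.cos τ) + r * Real.cos α * (ρ * Real.sin τ)
      = r * (ρ * (Real.sin α * Real.cos τ + Real.cos α * Real.sin τ)) := by ring
  rw [f1, f2, hcancel, hcancel, ← mul_add, mul_left_comm, mul_inv_cancel_left₀ hp.ne']

theorem lintegral_angleKernel_le {q : ℂ} (hq : q ≠ 0) (h0 : 0 ≤ q.arg) (h1 : q.arg < Real.pi) :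
    ∫⁻ z in upperHalf, ‖angleKernel z q‖ₑ ≤ 1 := by
  rw [lintegral_upperHalf_eq_polar]
  refine le_trans (le_of_eq ?_) (lintegral_polarKernel_le (norm_pos_iff.2 hq) h0 h1)
  refine setLIntegral_congr_fun (measurableSet_Ioi.prod measurableSet_Ioo) fun p hp => ?_
  have hp1 : 0 < p.1 := hp.1
  rw [← mul_angleKernel_polar hp1, enorm_mul, Real.enorm_of_nonneg hp1.le]

theorem integrableOn_polarKernel {ρ τ : ℝ} (hρ : 0 < ρ) (h0 : 0 ≤ τ) (h1 : τ < Real.pi) :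
    IntegrableOn (polarKernel ρ τ) (Set.Ioi (0 : ℝ) ×ˢ Set.Ioo 0 Real.pi) :=
  ⟨(measurable_polarKernel ρ τ).aestronglyMeasurable,
    (lintegral_polarKernel_le hρ h0 h1).trans_lt ENNReal.one_lt_top⟩

theorem arg_polarCoord_symm {p : ℝ × ℝ} (hp : 0 < p.1) (h0 : 0 < p.2) (h1 : p.2 < Real.pi) :
    (Complex.polarCoord.symm p).arg = p.2 := by
  rw [Complex.polarCoord_symm_apply, Complex.ofReal_cos, Complex.ofReal_sin,
    Complex.arg_mul_cos_add_sin_mul_I hp ⟨by linarith, h1.le⟩]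

/-- Integration over the upper half plane against the kernel of a function of the argument. -/
theorem integral_angleKernel_mul {q : ℂ} (hq : q ≠ 0) (h0 : 0 ≤ q.arg) (h1 : q.arg < Real.pi)
    {G : ℝ → ℝ} (hG : Continuous G) :
    ∫ z in upperHalf, angleKernel z q * G (z.arg / Real.pi) =
      (∫ s in (q.arg / Real.pi)..1, G s) - ∫ s in (0 : ℝ)..1, s * G s := by
  have hpi := Real.pi_pos
  obtain ⟨C, hC⟩ := (isCompact_Icc (a := (0 : ℝ)) (b := 1)).exists_bound_of_continuousOn
    hG.continuousOn
  have hint : IntegrableOn (fun p : ℝ × ℝ => polarKernel ‖q‖ q.arg p * G (p.2 / Real.pi))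
      (Set.Ioi (0 : ℝ) ×ˢ Set.Ioo 0 Real.pi) := by
    refine Integrable.mul_bdd (c := C)
      (integrableOn_polarKernel (norm_pos_iff.2 hq) h0 h1) ?_ ?_
    · exact (hG.comp (by fun_prop)).aestronglyMeasurable
    · refine (ae_restrict_mem (measurableSet_Ioi.prod measurableSet_Ioo)).mono fun p hp => ?_
      exact hC _ ⟨div_nonneg hp.2.1.le hpi.le, (div_le_one hpi).2 hp.2.2.le⟩
  calc ∫ z in upperHalf, angleKernel z q * G (z.arg / Real.pi)
      = ∫ p in Set.Ioi (0 : ℝ) ×ˢ Set.Ioo 0 Real.pi,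
          polarKernel ‖q‖ q.arg p * G (p.2 / Real.pi) := by
        rw [integral_upperHalf_eq_polar]
        refine setIntegral_congr_fun (measurableSet_Ioi.prod measurableSet_Ioo) fun p hp => ?_
        rw [← mul_assoc, mul_angleKernel_polar hp.1, arg_polarCoord_symm hp.1 hp.2.1 hp.2.2]
    _ = ∫ α in Set.Ioo 0 Real.pi, ∫ r in Set.Ioi (0 : ℝ),
          polarKernel ‖q‖ q.arg (r, α) * G (α / Real.pi) := by
        rw [Measure.volume_eq_prod, ← Measure.prod_restrict]
        rw [IntegrableOn, Measure.volume_eq_prod, ← Measure.prod_restrict] at hint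
        exact integral_prod_symm _ hint
    _ = ∫ α in Set.Ioo 0 Real.pi, Real.pi⁻¹ *
          (((Set.Ioi (q.arg / Real.pi)).indicator 1 (α / Real.pi) - α / Real.pi)
            * G (α / Real.pi)) := by
        have hne : ∀ᵐ α ∂(volume.restrict (Set.Ioo 0 Real.pi)), α ≠ q.arg :=
          ae_restrict_of_ae (Measure.ae_ne volume _)
        refine integral_congr_ae ?_
        filter_upwards [hne, ae_restrict_mem measurableSet_Ioo] with α hα hm
        obtain ⟨-, e, -⟩ := integrableOn_polarKernel_ray (norm_pos_iff.2 hq) h0 h1 hm.1 hm.2 hα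
        rw [integral_mul_const, e, one_div, mul_assoc]
        congr 3
        simp [Set.indicator_apply, div_lt_div_iff_of_pos_right hpi]
    _ = ∫ s in (0 : ℝ)..1, ((Set.Ioi (q.arg / Real.pi)).indicator 1 s - s) * G s := by
        rw [integral_const_mul, ← integral_Ioc_eq_integral_Ioo,
          ← intervalIntegral.integral_of_le hpi.le,
          intervalIntegral.integral_comp_div
            (fun s => ((Set.Ioi (q.arg / Real.pi)).indicator 1 s - s) * G s) hpi.ne']
        simp [hpi.ne']
    _ = _ := by
        have hθ0 : 0 ≤ q.arg / Real.pi := div_nonneg h0 hpi.le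
        have hθ1 : q.arg / Real.pi ≤ 1 := (div_le_one hpi).2 h1.le
        generalize q.arg / Real.pi = θ at *
        have hsm : ∀ s : ℝ, ((Set.Ioi θ).indicator 1 s - s) * G s
            = (Set.Ioi θ).indicator G s - s * G s := by
          intro s
          by_cases h : s ∈ Set.Ioi θ <;> simp [h, sub_mul]
        simp_rw [hsm]
        have hi : IntervalIntegrable ((Set.Ioi θ).indicator G) volume 0 1 := by
          have := hG.intervalIntegrable (μ := volume) 0 1
          rw [intervalIntegrable_iff] at this ⊢
          exact this.indicator measurableSet_Ioi
        have hi' : IntervalIntegrable (fun s => s * G s) volume 0 1 :=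
          (continuous_id.mul hG).intervalIntegrable 0 1
        rw [intervalIntegral.integral_sub hi hi']
        congr 1
        rw [intervalIntegral.integral_of_le zero_le_one, intervalIntegral.integral_of_le hθ1,
          setIntegral_indicator measurableSet_Ioi]
        congr 2
        ext s
        simp only [Set.mem_inter_iff, Set.mem_Ioc, Set.mem_Ioi]
        constructor
        · rintro ⟨⟨_, h⟩, h'⟩; exact ⟨h', h⟩
        · rintro ⟨h', h⟩; exact ⟨⟨by linarith, h⟩, h'⟩

/-- Exchanging the order of integration in the recursion of the functions `I`. -/
theorem integral_integral_eq {G : ℝ → ℝ} (hG : Continuous G) (θ : ℝ) :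
    ∫ lam in (0 : ℝ)..1, ∫ s in θ..lam, G s =
      (∫ s in θ..1, G s) - ∫ s in (0 : ℝ)..1, s * G s := by
  have hd : ∀ x ∈ Set.uIcc (0 : ℝ) 1, HasDerivAt (fun x => ∫ s in θ..x, G s) (G x) x :=
    fun x _ => intervalIntegral.integral_hasDerivAt_right (hG.intervalIntegrable _ _)
      (hG.stronglyMeasurableAtFilter _ _) hG.continuousAt
  have h := intervalIntegral.integral_mul_deriv_eq_deriv_mul (a := (0 : ℝ)) (b := 1)
    (u := fun x => x) (u' := fun _ => 1) (fun x _ => hasDerivAt_id x) hd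
    (continuous_const.intervalIntegrable _ _) (hG.intervalIntegrable _ _)
  simp only [one_mul, zero_mul, sub_zero] at h
  linarith

theorem BracketTree.continuous_I : ∀ e : BracketTree, Continuous e.I
  | .bullet => by
    unfold BracketTree.I
    fun_prop
  | .graft k ts => by
    have hG : Continuous fun s => ∏ i, (ts i).I s :=
      continuous_finsetProd _ fun i _ => (ts i).continuous_I
    unfold BracketTree.I
    simp_rw [integral_integral_eq hG]
    refine Continuous.sub ?_ continuous_const
    have : (fun θ => ∫ s in θ..(1 : ℝ), ∏ i, (ts i).I s)
        = fun θ => -∫ s in (1 : ℝ)..θ, ∏ i, (ts i).I s := by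
      ext θ; rw [intervalIntegral.integral_symm]
    rw [this]
    exact (intervalIntegral.continuous_primitive (fun a b => hG.intervalIntegrable a b) 1).neg

/-- Splitting a family of points indexed by the vertices of a graft into the point of the new root
and the families of points of the grafted trees. -/
def piGraftEquiv (X : Type*) [MeasurableSpace X] {ι : Type*} (V : ι → Type*) :
    (Option (Σ i, V i) → X) ≃ᵐ X × (∀ i, V i → X) where
  toFun z := (z none, fun i v => z (some ⟨i, v⟩))
  invFun p := fun o => o.elim p.1 fun s => p.2 s.1 s.2
  left_inv z := by
    ext o
    rcases o with _ | ⟨i, v⟩ <;> rfl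
  right_inv p := rfl
  measurable_toFun := by
    refine (measurable_pi_apply _).prodMk ?_
    exact measurable_pi_lambda _ fun i => measurable_pi_lambda _ fun v => measurable_pi_apply _
  measurable_invFun := by
    refine measurable_pi_lambda _ fun o => ?_
    rcases o with _ | ⟨i, v⟩
    · exact measurable_fst
    · exact (measurable_pi_apply v).comp ((measurable_pi_apply i).comp measurable_snd)

theorem measurePreserving_piGraftEquiv_symm {X : Type*} [MeasurableSpace X] {ι : Type*}
    [Fintype ι] (V : ι → Type*) [∀ i, Fintype (V i)] (μ : Measure X) [SigmaFinite μ] :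
    MeasurePreserving (piGraftEquiv X V).symm
      (μ.prod (Measure.pi fun i => Measure.pi fun _ : V i => μ)) (Measure.pi fun _ => μ) := by
  refine ⟨(piGraftEquiv X V).symm.measurable, (Measure.pi_eq fun s _ => ?_).symm⟩
  rw [(piGraftEquiv X V).symm.map_apply]
  have : (piGraftEquiv X V).symm ⁻¹' (Set.univ.pi s) =
      s none ×ˢ Set.univ.pi fun i => Set.univ.pi fun v => s (some ⟨i, v⟩) := by
    ext p
    simp only [Set.mem_preimage, Set.mem_pi, Set.mem_univ, forall_true_left, Set.mem_prod]
    constructor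
    · exact fun h => ⟨h none, fun i v => h (some ⟨i, v⟩)⟩
    · rintro ⟨h, h'⟩ (_ | ⟨i, v⟩)
      · exact h
      · exact h' i v
  rw [this, Measure.prod_prod, Measure.pi_pi, Fintype.prod_option, Fintype.prod_sigma]
  simp_rw [Measure.pi_pi]

/-- The density of the angle form of a rooted tree when the second edge of the root ends at `q`:
the product of the densities of the vertices. -/
noncomputable def RootedTreeOn.kernelProd {V : Type*} [Fintype V] (t : RootedTreeOn V) (q : ℂ)
    (z : V → ℂ) : ℝ :=
  ∏ v, angleKernel (z v) ((t.parent v).elim q z)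

theorem RootedTreeOn.measurable_kernelProd {V : Type*} [Fintype V] (t : RootedTreeOn V) :
    Measurable fun p : ℂ × (V → ℂ) => t.kernelProd p.1 p.2 := by
  refine Finset.measurable_prod _ fun v _ => ?_
  have h1 : Measurable fun p : ℂ × (V → ℂ) => p.2 v := (measurable_pi_apply v).comp measurable_snd
  have h2 : Measurable fun p : ℂ × (V → ℂ) => (t.parent v).elim p.1 p.2 := by
    cases t.parent v with
    | none => exact measurable_fst
    | some w => exact (measurable_pi_apply w).comp measurable_snd
  exact measurable_angleKernel.comp (h1.prodMk h2)

theorem RootedTreeOn.measurable_kernelProd_right {V : Type*} [Fintype V] (t : RootedTreeOn V)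
    (q : ℂ) : Measurable (t.kernelProd q) :=
  Measurable.of_uncurry_left (f := t.kernelProd) t.measurable_kernelProd

theorem RootedTreeOn.kernelProd_graft {ι : Type*} [Fintype ι] {V : ι → Type*}
    [∀ i, Fintype (V i)] (ts : ∀ i, RootedTreeOn (V i)) (q : ℂ) (z : Option (Σ i, V i) → ℂ) :
    (RootedTreeOn.graft ts).kernelProd q z = angleKernel (z none) q *
      ∏ i, (ts i).kernelProd (z none) fun v => z (some ⟨i, v⟩) := by
  rw [RootedTreeOn.kernelProd, Fintype.prod_option, Fintype.prod_sigma]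
  refine congrArg₂ _ rfl (Finset.prod_congr rfl fun i _ => Finset.prod_congr rfl fun v _ => ?_)
  simp only [RootedTreeOn.graft, Option.elim_some]
  cases (ts i).parent v <;> rfl

/-- Lebesgue measure on the upper half plane. -/
noncomputable def halfPlaneMeasure : Measure ℂ := volume.restrict upperHalf

instance : SigmaFinite halfPlaneMeasure := by
  unfold halfPlaneMeasure
  infer_instance

/-- The integral of the angle form of `t`, as a function of the end point `q` of the second edge
of the root, converges absolutely and is the function `f` of the angle `φ(q, 0)`. -/
def RootedTreeOn.HasAngleIntegral {V : Type*} [Fintype V] (t : RootedTreeOn V) (f : ℝ → ℝ) :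
    Prop :=
  ∀ q : ℂ, q ≠ 0 → 0 ≤ q.arg → q.arg < Real.pi →
    Integrable (t.kernelProd q) (Measure.pi fun _ => halfPlaneMeasure) ∧
    ∫ z, ‖t.kernelProd q z‖ ∂(Measure.pi fun _ => halfPlaneMeasure) ≤ 1 ∧
    ∫ z, t.kernelProd q z ∂(Measure.pi fun _ => halfPlaneMeasure) = f (q.arg / Real.pi)

theorem arg_mem_of_mem_upperHalf {z : ℂ} (hz : z ∈ upperHalf) :
    z ≠ 0 ∧ 0 ≤ z.arg ∧ z.arg < Real.pi := by
  have hz' : 0 < z.im := hz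
  refine ⟨?_, Complex.arg_nonneg_iff.2 hz'.le, Complex.arg_lt_pi_iff.2 (Or.inr hz'.ne')⟩
  rintro rfl
  simp at hz'

theorem integrable_norm_le_one_of_lintegral {X : Type*} [MeasurableSpace X] {μ : Measure X}
    {f : X → ℝ} (hf : AEStronglyMeasurable f μ) (h : ∫⁻ x, ‖f x‖ₑ ∂μ ≤ 1) :
    Integrable f μ ∧ ∫ x, ‖f x‖ ∂μ ≤ 1 := by
  have hi : Integrable f μ := ⟨hf, h.trans_lt ENNReal.one_lt_top⟩
  refine ⟨hi, ?_⟩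
  rw [← ofReal_integral_norm_eq_lintegral_enorm hi] at h
  exact ENNReal.ofReal_le_one.1 h

theorem RootedTreeOn.hasAngleIntegral_single :
    RootedTreeOn.single.HasAngleIntegral fun θ => 1 / 2 - θ := by
  intro q hq h0 h1
  have hmp := measurePreserving_funUnique halfPlaneMeasure Unit
  have hD : RootedTreeOn.single.kernelProd q
      = (fun z => angleKernel z q) ∘ MeasurableEquiv.funUnique Unit ℂ := by
    ext z
    simp [RootedTreeOn.kernelProd, RootedTreeOn.single]
  have hm := RootedTreeOn.single.measurable_kernelProd_right q
  have hle : ∫⁻ z, ‖RootedTreeOn.single.kernelProd q z‖ₑ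
      ∂(Measure.pi fun _ => halfPlaneMeasure) ≤ 1 := by
    rw [hD]
    refine le_trans (le_of_eq ?_) (lintegral_angleKernel_le hq h0 h1)
    exact hmp.lintegral_comp_emb (MeasurableEquiv.measurableEmbedding _)
      fun z => ‖angleKernel z q‖ₑ
  obtain ⟨ha, hb⟩ := integrable_norm_le_one_of_lintegral hm.aestronglyMeasurable hle
  refine ⟨ha, hb, ?_⟩
  rw [hD]
  have h2 := integral_angleKernel_mul hq h0 h1 (G := fun _ => 1) continuous_const
  simp only [mul_one, intervalIntegral.integral_const, smul_eq_mul, integral_id] at h2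
  refine (hmp.integral_comp (MeasurableEquiv.measurableEmbedding _)
    fun z => angleKernel z q).trans ?_
  rw [halfPlaneMeasure, h2]
  ring

theorem RootedTreeOn.hasAngleIntegral_graft {ι : Type*} [Fintype ι] {V : ι → Type*}
    [∀ i, Fintype (V i)] {ts : ∀ i, RootedTreeOn (V i)} {f : ι → ℝ → ℝ}
    (hf : ∀ i, Continuous (f i)) (h : ∀ i, (ts i).HasAngleIntegral (f i)) :
    (RootedTreeOn.graft ts).HasAngleIntegral
      fun θ => ∫ lam in (0 : ℝ)..1, ∫ s in θ..lam, ∏ i, f i s := by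
  intro q hq h0 h1
  have hmp := measurePreserving_piGraftEquiv_symm V halfPlaneMeasure
  have hemb := (piGraftEquiv ℂ V).symm.measurableEmbedding
  have hm := (RootedTreeOn.graft ts).measurable_kernelProd_right q
  have hD : ∀ p, (RootedTreeOn.graft ts).kernelProd q ((piGraftEquiv ℂ V).symm p)
      = angleKernel p.1 q * ∏ i, (ts i).kernelProd p.1 (p.2 i) := by
    intro p
    rw [RootedTreeOn.kernelProd_graft]
    rfl
  have hm' : Measurable fun p : ℂ × (∀ i, V i → ℂ) =>
      angleKernel p.1 q * ∏ i, (ts i).kernelProd p.1 (p.2 i) := by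
    simp_rw [← hD]
    exact hm.comp (piGraftEquiv ℂ V).symm.measurable
  have hle : ∫⁻ z, ‖(RootedTreeOn.graft ts).kernelProd q z‖ₑ
      ∂(Measure.pi fun _ => halfPlaneMeasure) ≤ 1 := by
    rw [← hmp.lintegral_comp_emb hemb]
    simp_rw [hD]
    rw [lintegral_prod _ hm'.enorm.aemeasurable]
    refine le_trans (lintegral_mono_ae ?_) (lintegral_angleKernel_le hq h0 h1)
    refine (ae_restrict_mem measurableSet_upperHalf).mono fun x hx => ?_
    obtain ⟨a0, a1, a2⟩ := arg_mem_of_mem_upperHalf hx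
    simp_rw [enorm_mul]
    rw [lintegral_const_mul' _ _ enorm_ne_top]
    refine mul_le_of_le_one_right' ?_
    rw [← ofReal_integral_norm_eq_lintegral_enorm
      (Integrable.fintype_prod_dep fun i => (h i x a0 a1 a2).1)]
    refine ENNReal.ofReal_le_one.2 ?_
    simp_rw [norm_prod]
    rw [integral_fintype_prod_eq_prod (fun i y => ‖(ts i).kernelProd x y‖)]
    exact Finset.prod_le_one (fun i _ => integral_nonneg fun _ => norm_nonneg _)
      fun i _ => (h i x a0 a1 a2).2.1
  obtain ⟨ha, hb⟩ := integrable_norm_le_one_of_lintegral hm.aestronglyMeasurable hle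
  refine ⟨ha, hb, ?_⟩
  have hi := (hmp.integrable_comp_emb hemb).2 ha
  rw [← hmp.integral_comp hemb]
  simp only [Function.comp_def, hD] at hi ⊢
  rw [integral_prod _ hi]
  have hG : Continuous fun s => ∏ i, f i s := continuous_finsetProd _ fun i _ => hf i
  rw [integral_integral_eq hG, ← integral_angleKernel_mul hq h0 h1 hG]
  refine setIntegral_congr_fun measurableSet_upperHalf fun x hx => ?_
  obtain ⟨a0, a1, a2⟩ := arg_mem_of_mem_upperHalf hx
  simp only
  rw [integral_const_mul, integral_fintype_prod_eq_prod (fun i y => (ts i).kernelProd x y)]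
  congr 1
  exact Finset.prod_congr rfl fun i _ => (h i x a0 a1 a2).2.2

theorem BracketTree.hasAngleIntegral : ∀ e : BracketTree, e.toRootedTree.HasAngleIntegral e.I
  | .bullet => RootedTreeOn.hasAngleIntegral_single
  | .graft _ ts => RootedTreeOn.hasAngleIntegral_graft (fun i => (ts i).continuous_I)
      fun i => (ts i).hasAngleIntegral

theorem RootedTreeOn.Iso.hasAngleIntegral {V V' : Type*} [Fintype V] [Fintype V']
    {t : RootedTreeOn V} {t' : RootedTreeOn V'} (σ : t.Iso t') {f : ℝ → ℝ}
    (h : t'.HasAngleIntegral f) : t.HasAngleIntegral f := by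
  intro q hq h0 h1
  have hmp := measurePreserving_piCongrLeft (fun _ : V' => halfPlaneMeasure) σ.toEquiv
  have hemb := (MeasurableEquiv.piCongrLeft (fun _ : V' => ℂ) σ.toEquiv).measurableEmbedding
  obtain ⟨a, b, c⟩ := h q hq h0 h1
  have hD : ∀ z : V → ℂ, t'.kernelProd q
      (MeasurableEquiv.piCongrLeft (fun _ : V' => ℂ) σ.toEquiv z) = t.kernelProd q z := by
    intro z
    have hz : ∀ v, MeasurableEquiv.piCongrLeft (fun _ : V' => ℂ) σ.toEquiv z (σ.toEquiv v)
        = z v := fun v =>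
          MeasurableEquiv.piCongrLeft_apply_apply σ.toEquiv (β := fun _ => ℂ) z v
    rw [RootedTreeOn.kernelProd, RootedTreeOn.kernelProd, ← σ.toEquiv.prod_comp]
    refine Finset.prod_congr rfl fun v _ => ?_
    rw [hz, show t'.parent (σ.toEquiv v) = (t.parent v).map σ.toEquiv from σ.map_parent v]
    cases t.parent v with
    | none => rfl
    | some w => simp only [Option.map_some, Option.elim_some, hz]
  refine ⟨?_, ?_, ?_⟩
  · have := (hmp.integrable_comp_emb hemb).2 a
    simpa only [Function.comp_def, hD] using this
  · rw [← hmp.integral_comp hemb] at b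
    simpa only [hD] using b
  · rw [← hmp.integral_comp hemb] at c
    simpa only [hD] using c

/-- The logarithmic derivative in `p` of `(q - p) (conj q - p)`. -/
noncomputable def angleCoeff (p q : ℂ) : ℂ := (p - q)⁻¹ + (p - (starRingEnd ℂ) q)⁻¹

theorem angle_eq_fract_arg {p q : ℂ} (h : p.re ≠ q.re) :
    angle p q = Int.fract (Complex.arg ((q - p) * ((starRingEnd ℂ) q - p)) / (2 * Real.pi)) := by
  have h0 : q - (starRingEnd ℂ) p ≠ 0 := fun h' => h (by
    have := congrArg Complex.re h'
    simp at this
    linarith)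
  have h1 : (q - p) / (q - (starRingEnd ℂ) p)
      = ((Complex.normSq (q - (starRingEnd ℂ) p))⁻¹ : ℝ) * ((q - p) * ((starRingEnd ℂ) q - p)) := by
    rw [div_eq_mul_inv, Complex.inv_def, map_sub, Complex.conj_conj]
    ring
  rw [angle, h1, Complex.arg_real_mul _ (inv_pos.2 (Complex.normSq_pos.2 h0))]

theorem fract_arg_eq {w : ℂ} (hw : w.im ≠ 0) :
    Int.fract (w.arg / (2 * Real.pi)) = w.arg / (2 * Real.pi) + if 0 < w.im then 0 else 1 := by
  have hpi := Real.pi_pos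
  split_ifs with h
  · have h0 := Complex.arg_nonneg_iff.2 h.le
    have h1 := Complex.arg_le_pi w
    rw [add_zero, Int.fract_eq_self]
    exact ⟨by positivity, by rw [div_lt_one (by positivity)]; linarith⟩
  · have h0 : w.arg < 0 := Complex.arg_neg_iff.2 (lt_of_le_of_ne (not_lt.1 h) hw)
    have h1 := Complex.neg_pi_lt_arg w
    rw [← Int.fract_add_one, Int.fract_eq_self]
    constructor
    · have : -1 ≤ w.arg / (2 * Real.pi) := by
        rw [le_div_iff₀ (by positivity)]
        linarith
      linarith
    · have : w.arg / (2 * Real.pi) < 0 := div_neg_of_neg_of_pos h0 (by positivity)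
      linarith

theorem im_mul_conj_sub (p q : ℂ) :
    ((q - p) * ((starRingEnd ℂ) q - p)).im = 2 * p.im * (p.re - q.re) := by
  simp
  ring

theorem exists_hasFDerivAt_angle {p q : ℂ} (hp : 0 < p.im) (h : p.re ≠ q.re) :
    ∃ A : ℂ × ℂ →L[ℝ] ℝ, HasFDerivAt (fun x : ℂ × ℂ => angle x.1 x.2) A (p, q) ∧
      ∀ v, A (v, 0) = (2 * Real.pi)⁻¹ * (angleCoeff p q * v).im := by
  set N : ℂ × ℂ → ℂ := fun x => (x.2 - x.1) * ((starRingEnd ℂ) x.2 - x.1) with hN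
  have hNim : ∀ x, (N x).im = 2 * x.1.im * (x.1.re - x.2.re) := fun x => im_mul_conj_sub _ _
  have hNc : Continuous N := by fun_prop
  have him : (N (p, q)).im ≠ 0 := by
    rw [hNim]
    exact mul_ne_zero (by positivity) (sub_ne_zero.2 h)
  have d1 : HasFDerivAt (fun x : ℂ × ℂ => x.2 - x.1)
      (ContinuousLinearMap.snd ℝ ℂ ℂ - ContinuousLinearMap.fst ℝ ℂ ℂ) (p, q) :=
    hasFDerivAt_snd.sub hasFDerivAt_fst
  have d2 : HasFDerivAt (fun x : ℂ × ℂ => (starRingEnd ℂ) x.2 - x.1)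
      ((Complex.conjCLE : ℂ →L[ℝ] ℂ).comp (ContinuousLinearMap.snd ℝ ℂ ℂ)
        - ContinuousLinearMap.fst ℝ ℂ ℂ) (p, q) :=
    ((Complex.conjCLE : ℂ →L[ℝ] ℂ).comp (ContinuousLinearMap.snd ℝ ℂ ℂ)).hasFDerivAt.sub
      hasFDerivAt_fst
  have d3 := d1.mul d2
  have d4 := (Complex.hasDerivAt_log
    (Complex.mem_slitPlane_iff.2 (Or.inr him))).complexToReal_fderiv
  have d5 := (Complex.imCLM.hasFDerivAt.comp _ (d4.comp (p, q) d3)).const_mul (2 * Real.pi)⁻¹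
  refine ⟨_, (d5.add_const (if 0 < (N (p, q)).im then 0 else 1)).congr_of_eventuallyEq ?_, ?_⟩
  · have e1 : ∀ᶠ x : ℂ × ℂ in nhds (p, q), x.1.re ≠ x.2.re := by
      have hc : Continuous fun x : ℂ × ℂ => x.1.re - x.2.re := by fun_prop
      filter_upwards [hc.continuousAt.eventually_ne (sub_ne_zero.2 h)] with x hx
      exact sub_ne_zero.1 hx
    have hc : Continuous fun x => (N x).im := Complex.continuous_im.comp hNc
    have e2 : ∀ᶠ x in nhds (p, q), (N x).im ≠ 0 ∧ (0 < (N x).im ↔ 0 < (N (p, q)).im) := by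
      rcases lt_or_gt_of_ne him with hlt | hgt
      · filter_upwards [hc.continuousAt.eventually_lt continuousAt_const hlt] with x hx
        exact ⟨hx.ne, iff_of_false hx.not_gt hlt.not_gt⟩
      · filter_upwards [continuousAt_const.eventually_lt hc.continuousAt hgt] with x hx
        exact ⟨hx.ne', iff_of_true hx hgt⟩
    filter_upwards [e1, e2] with x h1 h2
    rw [angle_eq_fract_arg h1, fract_arg_eq h2.1]
    simp only [h2.2, Function.comp_apply, Complex.imCLM_apply, Complex.log_im]
    rw [div_eq_inv_mul]
  · intro v
    have hN0 : (q - p) * ((starRingEnd ℂ) q - p) ≠ 0 := fun h0 => him (by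
      change ((q - p) * ((starRingEnd ℂ) q - p)).im = 0
      rw [h0]; rfl)
    have hq1 : q - p ≠ 0 := left_ne_zero_of_mul hN0
    have hq2 : (starRingEnd ℂ) q - p ≠ 0 := right_ne_zero_of_mul hN0
    change (2 * Real.pi)⁻¹ * (((q - p) * ((starRingEnd ℂ) q - p))⁻¹ *
      ((q - p) * ((starRingEnd ℂ) 0 - v) + ((starRingEnd ℂ) q - p) * (0 - v))).im = _
    congr 2
    rw [angleCoeff, map_zero, ← neg_sub q p, ← neg_sub ((starRingEnd ℂ) q) p]
    field_simp
    ring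

theorem angleKernel_eq_det (p q : ℂ) :
    (2 * Real.pi)⁻¹ * (angleCoeff p 0 * 1).im * ((2 * Real.pi)⁻¹ * (angleCoeff p q * Complex.I).im)
      - (2 * Real.pi)⁻¹ * (angleCoeff p 0 * Complex.I).im * ((2 * Real.pi)⁻¹ *
        (angleCoeff p q * 1).im) = angleKernel p q := by
  have hpi := Real.pi_pos
  simp only [angleCoeff, angleKernel, map_zero, sub_zero, mul_one, Complex.mul_im, Complex.I_re,
    Complex.I_im, mul_zero, add_zero, Complex.add_re, Complex.add_im, Complex.inv_re,
    Complex.inv_im, Complex.sub_re, Complex.sub_im, Complex.conj_re, Complex.conj_im]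
  generalize Complex.normSq (p - q) = A
  generalize Complex.normSq (p - (starRingEnd ℂ) q) = B
  generalize Complex.normSq p = C
  simp only [div_eq_mul_inv, mul_inv]
  ring

section

variable {V : Type*} [Fintype V]

/-- The derivative of the position of a vertex. -/
noncomputable def positionDeriv (V : Type*) [Fintype V] : V ⊕ Fin 2 → (V → ℂ) →L[ℝ] ℂ
  | Sum.inl k => ContinuousLinearMap.proj k
  | Sum.inr _ => 0

theorem hasFDerivAt_position (s : V ⊕ Fin 2) (z : V → ℂ) :
    HasFDerivAt (fun z => KontsevichGraph.position z s) (positionDeriv V s) z := by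
  rcases s with k | j
  · exact (ContinuousLinearMap.proj (R := ℝ) (φ := fun _ : V => ℂ) k).hasFDerivAt
  · exact hasFDerivAt_const _ _

theorem KontsevichGraph.exists_fderiv_edgeAngle (Γ : KontsevichGraph V 2) {k : V} {i : Fin 2}
    {z : V → ℂ} (hk : 0 < (z k).im) (h : (z k).re ≠ (position z (Γ.target k i)).re) :
    ∃ A : ℂ × ℂ →L[ℝ] ℝ,
      (∀ u, fderiv ℝ (Γ.edgeAngle k i) z u = A (u k, positionDeriv V (Γ.target k i) u)) ∧
      ∀ v, A (v, 0) = (2 * Real.pi)⁻¹ * (angleCoeff (z k) (position z (Γ.target k i)) * v).im := by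
  obtain ⟨A, hA, hA'⟩ := exists_hasFDerivAt_angle hk h
  refine ⟨A, fun u => ?_, hA'⟩
  have h1 := (ContinuousLinearMap.proj (R := ℝ) (φ := fun _ : V => ℂ) k).hasFDerivAt (x := z)
  have h2 := HasFDerivAt.comp (f := fun z : V → ℂ => (z k, position z (Γ.target k i))) z hA
    (h1.prodMk (hasFDerivAt_position (Γ.target k i) z))
  have h3 : HasFDerivAt (Γ.edgeAngle k i) _ z := h2
  rw [h3.fderiv]
  rfl

theorem ae_linear_ne (ℓ : (V → ℂ) →ₗ[ℝ] ℝ) (hℓ : ℓ ≠ 0) (c : ℝ) :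
    ∀ᵐ z : V → ℂ, ℓ z ≠ c := by
  have h := Measure.addHaar_affineSubspace (volume : Measure (V → ℂ))
    ((AffineSubspace.mk' c ⊥).comap ℓ.toAffineMap) ?_
  · rw [ae_iff]
    convert h using 2
    ext z
    simp [sub_eq_zero]
  · intro htop
    obtain ⟨z, hz⟩ := LinearMap.surjective hℓ (c + 1)
    have : z ∈ (AffineSubspace.mk' c ⊥).comap ℓ.toAffineMap := by
      rw [htop]
      trivial
    simp [hz] at this

theorem pi_halfPlaneMeasure :
    (Measure.pi fun _ : V => halfPlaneMeasure) =
      (volume : Measure (V → ℂ)).restrict (Set.univ.pi fun _ => upperHalf) :=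
  (Measure.restrict_pi_pi (fun _ : V => (volume : Measure ℂ)) fun _ => upperHalf).symm

variable [DecidableEq V]

theorem KontsevichGraph.fderiv_edgeAngle_single_self (Γ : KontsevichGraph V 2) {k : V} {i : Fin 2}
    {z : V → ℂ} (hk : 0 < (z k).im) (h : (z k).re ≠ (position z (Γ.target k i)).re) (v : ℂ) :
    fderiv ℝ (Γ.edgeAngle k i) z (Pi.single k v) =
      (2 * Real.pi)⁻¹ * (angleCoeff (z k) (position z (Γ.target k i)) * v).im := by
  obtain ⟨A, h1, h2⟩ := Γ.exists_fderiv_edgeAngle hk h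
  rw [h1, ← h2, Pi.single_eq_same]
  congr 2
  have hl := Γ.no_loop k i
  cases hs : Γ.target k i with
  | inl l =>
    have : l ≠ k := fun hlk => hl (by rw [hs, hlk])
    exact Pi.single_eq_of_ne (M := fun _ : V => ℂ) this v
  | inr j => rfl

theorem KontsevichGraph.fderiv_edgeAngle_single_of_ne (Γ : KontsevichGraph V 2) {k l : V}
    {i : Fin 2} {z : V → ℂ} (hk : 0 < (z k).im) (h : (z k).re ≠ (position z (Γ.target k i)).re)
    (hl : l ≠ k) (hl' : Γ.target k i ≠ Sum.inl l) (v : ℂ) :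
    fderiv ℝ (Γ.edgeAngle k i) z (Pi.single l v) = 0 := by
  obtain ⟨A, h1, -⟩ := Γ.exists_fderiv_edgeAngle hk h
  rw [h1, Pi.single_eq_of_ne hl.symm]
  have : positionDeriv V (Γ.target k i) (Pi.single l v) = 0 := by
    cases hs : Γ.target k i with
    | inl m =>
      have : m ≠ l := fun hml => hl' (by rw [hs, hml])
      exact Pi.single_eq_of_ne (M := fun _ : V => ℂ) this v
    | inr j => rfl
  rw [this]
  exact A.map_zero

/-- The determinant of a block triangular matrix with blocks of size two. -/
theorem det_eq_prod_of_triangular {α R : Type*} [CommRing R] [LinearOrder α]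
    (M : Matrix (V × Fin 2) (V × Fin 2) R)
    (b : V → α) (hb : Function.Injective b)
    (h : ∀ k l, b l < b k → ∀ i j, M (k, i) (l, j) = 0) :
    M.det = ∏ k, (M (k, 0) (k, 0) * M (k, 1) (k, 1) - M (k, 0) (k, 1) * M (k, 1) (k, 0)) := by
  have ht : M.BlockTriangular fun a => b a.1 := fun a c hac => h a.1 c.1 hac a.2 c.2
  have him : Finset.univ.image (fun a : V × Fin 2 => b a.1) = Finset.univ.image b := by
    ext x
    simp
  rw [ht.det, him, Finset.prod_image fun _ _ _ _ hxy => hb hxy]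
  refine Finset.prod_congr rfl fun k _ => ?_
  let σ : Fin 2 ≃ {a : V × Fin 2 // b a.1 = b k} :=
    { toFun := fun i => ⟨(k, i), rfl⟩
      invFun := fun a => a.1.2
      left_inv := fun _ => rfl
      right_inv := by
        rintro ⟨⟨l, i⟩, hl⟩
        obtain rfl := hb hl
        rfl }
  rw [← Matrix.det_submatrix_equiv_self σ, Matrix.det_fin_two]
  rfl

theorem RootedTreeOn.angleFormDensity_eq (t : RootedTreeOn V) {z : V → ℂ}
    (him : ∀ k, 0 < (z k).im) (h0 : ∀ k, (z k).re ≠ 0) (h1 : ∀ k, (z k).re ≠ 1)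
    (hne : ∀ k l, k ≠ l → (z k).re ≠ (z l).re) :
    t.kontsevichTree.angleFormDensity z = t.kernelProd 1 z := by
  have ht0 : ∀ k, t.kontsevichTree.target k 0 = Sum.inr 0 := fun k => rfl
  have ht1 : ∀ k, t.kontsevichTree.target k 1 = (t.parent k).elim (Sum.inr 1) Sum.inl := by
    intro k
    simp only [RootedTreeOn.kontsevichTree]
    cases t.parent k <;> rfl
  have hpos : ∀ k, KontsevichGraph.position z (t.kontsevichTree.target k 1)
      = (t.parent k).elim 1 z := by
    intro k
    rw [ht1]
    cases t.parent k <;> rfl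
  have hre : ∀ k i, (z k).re ≠ (KontsevichGraph.position z (t.kontsevichTree.target k i)).re := by
    intro k i
    fin_cases i
    · exact h0 k
    · change _ ≠ (KontsevichGraph.position z (t.kontsevichTree.target k 1)).re
      rw [hpos]
      cases hp : t.parent k with
      | none => exact h1 k
      | some w => exact hne k w fun hkw => t.parent_ne_self k (hkw ▸ hp)
  obtain ⟨d, hd⟩ := t.exists_depth
  let b : V → (ℕ ×ₗ Fin (Fintype.card V))ᵒᵈ :=
    fun v => OrderDual.toDual (toLex (d v, Fintype.equivFin V v))
  have hb : Function.Injective b := fun v w hvw =>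
    (Fintype.equivFin V).injective (Prod.ext_iff.1 (toLex.injective
      (OrderDual.toDual.injective hvw))).2
  rw [KontsevichGraph.angleFormDensity, det_eq_prod_of_triangular _ b hb]
  · refine Finset.prod_congr rfl fun k _ => ?_
    simp only [Matrix.of_apply]
    rw [KontsevichGraph.fderiv_edgeAngle_single_self _ (him k) (hre k 0),
      KontsevichGraph.fderiv_edgeAngle_single_self _ (him k) (hre k 1),
      KontsevichGraph.fderiv_edgeAngle_single_self _ (him k) (hre k 0),
      KontsevichGraph.fderiv_edgeAngle_single_self _ (him k) (hre k 1), hpos, ht0]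
    exact angleKernel_eq_det _ _
  · intro k l hlk i j
    have hlk' : toLex (d k, Fintype.equivFin V k) < toLex (d l, Fintype.equivFin V l) := hlk
    have hkl : d k ≤ d l := by
      rcases Prod.Lex.toLex_lt_toLex.1 hlk' with h | h
      · exact h.le
      · exact h.1.le
    refine KontsevichGraph.fderiv_edgeAngle_single_of_ne _ (him k) (hre k i) ?_ ?_ _
    · rintro rfl
      exact lt_irrefl _ hlk
    · fin_cases i
      · exact Sum.inr_ne_inl
      · change t.kontsevichTree.target k 1 ≠ Sum.inl l
        rw [ht1]
        cases hp : t.parent k with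
        | none => exact Sum.inr_ne_inl
        | some w =>
          intro hw
          cases hw
          exact absurd (hd _ _ hp) (not_lt.2 hkl)

theorem ae_re_ne (k : V) (c : ℝ) : ∀ᵐ z : V → ℂ, (z k).re ≠ c := by
  refine ae_linear_ne (Complex.reLm.comp (LinearMap.proj k)) (fun h => ?_) c
  have := LinearMap.congr_fun h (Pi.single k 1)
  simp at this

theorem ae_re_ne_re {k l : V} (hkl : k ≠ l) : ∀ᵐ z : V → ℂ, (z k).re ≠ (z l).re := by
  have h := ae_linear_ne (Complex.reLm.comp (LinearMap.proj k)
    - Complex.reLm.comp (LinearMap.proj l)) (fun h => ?_) 0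
  · filter_upwards [h] with z hz
    exact fun he => hz (by simp [he])
  · have := LinearMap.congr_fun h (Pi.single k 1)
    simp [Pi.single_eq_of_ne hkl.symm] at this

theorem configSpace_ae_eq :
    configSpace V =ᵐ[volume] (Set.univ.pi fun _ => upperHalf : Set (V → ℂ)) := by
  have h : ∀ᵐ z : V → ℂ, ∀ k l, k ≠ l → (z k).re ≠ (z l).re :=
    ae_all_iff.2 fun k => ae_all_iff.2 fun l => ae_all_iff.2 fun hkl => ae_re_ne_re hkl
  filter_upwards [h] with z hz
  refine propext ⟨fun hm k _ => hm.1 k, fun hm => ⟨fun k => hm k trivial, fun k l hkl => ?_⟩⟩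
  by_contra hne
  exact hz k l hne (congrArg Complex.re hkl)

theorem restrict_configSpace :
    (volume : Measure (V → ℂ)).restrict (configSpace V) =
      Measure.pi fun _ : V => halfPlaneMeasure := by
  rw [pi_halfPlaneMeasure, Measure.restrict_congr_set configSpace_ae_eq]

theorem RootedTreeOn.ae_angleFormDensity_eq (t : RootedTreeOn V) :
    t.kontsevichTree.angleFormDensity =ᵐ[Measure.pi fun _ => halfPlaneMeasure]
      t.kernelProd 1 := by
  rw [pi_halfPlaneMeasure]
  have h : ∀ᵐ z : V → ℂ, ∀ k l, k ≠ l → (z k).re ≠ (z l).re :=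
    ae_all_iff.2 fun k => ae_all_iff.2 fun l => ae_all_iff.2 fun hkl => ae_re_ne_re hkl
  have h0 : ∀ᵐ z : V → ℂ, ∀ k, (z k).re ≠ 0 := ae_all_iff.2 fun k => ae_re_ne k 0
  have h1 : ∀ᵐ z : V → ℂ, ∀ k, (z k).re ≠ 1 := ae_all_iff.2 fun k => ae_re_ne k 1
  filter_upwards [ae_restrict_of_ae h, ae_restrict_of_ae h0, ae_restrict_of_ae h1,
    ae_restrict_mem (MeasurableSet.univ_pi fun _ => measurableSet_upperHalf)] with z a b c d
  exact t.angleFormDensity_eq (fun k => d k trivial) b c a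

theorem RootedTreeOn.HasAngleIntegral.weight_eq {t : RootedTreeOn V} {f : ℝ → ℝ}
    (h : t.HasAngleIntegral f) :
    IntegrableOn t.kontsevichTree.angleFormDensity (configSpace V) ∧ t.weight = f 0 := by
  obtain ⟨a, -, c⟩ := h 1 one_ne_zero (by simp) (by simp [Real.pi_pos])
  have hae := t.ae_angleFormDensity_eq
  rw [IntegrableOn, RootedTreeOn.weight, KontsevichGraph.weight, restrict_configSpace]
  refine ⟨a.congr hae.symm, ?_⟩
  rw [integral_congr_ae hae, c]
  simp

end

theorem BracketTree.weight_eq (e : BracketTree) : e.toRootedTree.weight = e.I 0 :=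
  e.hasAngleIntegral.weight_eq.2

theorem BracketTree.I_graft (k : ℕ) (ts : Fin (k + 1) → BracketTree) (θ : ℝ) :
    (BracketTree.graft k ts).I θ =
      (∫ s in θ..1, ∏ i, (ts i).I s) - ∫ s in (0 : ℝ)..1, s * ∏ i, (ts i).I s := by
  rw [← integral_integral_eq (continuous_finsetProd _ fun i _ => (ts i).continuous_I)]
  simp only [BracketTree.I]

theorem integral_cubic (c₀ c₁ c₂ c₃ a b : ℝ) :
    ∫ s in a..b, (c₀ + c₁ * s + c₂ * s ^ 2 + c₃ * s ^ 3) =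
      (c₀ * b + c₁ * b ^ 2 / 2 + c₂ * b ^ 3 / 3 + c₃ * b ^ 4 / 4) -
        (c₀ * a + c₁ * a ^ 2 / 2 + c₂ * a ^ 3 / 3 + c₃ * a ^ 4 / 4) := by
  refine intervalIntegral.integral_eq_sub_of_hasDerivAt (f := fun x =>
    c₀ * x + c₁ * x ^ 2 / 2 + c₂ * x ^ 3 / 3 + c₃ * x ^ 4 / 4) (fun x _ => ?_)
    (Continuous.intervalIntegrable (by fun_prop) _ _)
  have h := (((((hasDerivAt_id x).const_mul c₀).add
    (((hasDerivAt_pow 2 x).const_mul c₁).div_const 2)).add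
    (((hasDerivAt_pow 3 x).const_mul c₂).div_const 3)).add
    (((hasDerivAt_pow 4 x).const_mul c₃).div_const 4))
  refine h.congr_deriv ?_
  norm_num
  ring

theorem BracketTree.I_graft_bullet (θ : ℝ) :
    (BracketTree.graft 0 ![.bullet]).I θ = 1 / 12 - θ / 2 + θ ^ 2 / 2 := by
  rw [BracketTree.I_graft]
  have h1 : ∀ s : ℝ, ∏ i, (![BracketTree.bullet] i).I s
      = 1 / 2 + (-1) * s + 0 * s ^ 2 + 0 * s ^ 3 := fun s => by
    simp [BracketTree.I]
    ring
  have h2 : ∀ s : ℝ, s * ∏ i, (![BracketTree.bullet] i).I s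
      = 0 + 1 / 2 * s + (-1) * s ^ 2 + 0 * s ^ 3 := fun s => by
    rw [h1]
    ring
  simp_rw [h2, h1, integral_cubic]
  ring

theorem BracketTree.I_graft_bullet_bullet_zero :
    (BracketTree.graft 1 ![.bullet, .bullet]).I 0 = 1 / 24 := by
  rw [BracketTree.I_graft]
  have h1 : ∀ s : ℝ, ∏ i, (![BracketTree.bullet, BracketTree.bullet] i).I s
      = 1 / 4 + (-1) * s + 1 * s ^ 2 + 0 * s ^ 3 := fun s => by
    simp [BracketTree.I]
    ring
  have h2 : ∀ s : ℝ, s * ∏ i, (![BracketTree.bullet, BracketTree.bullet] i).I s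
      = 0 + 1 / 4 * s + (-1) * s ^ 2 + 1 * s ^ 3 := fun s => by
    rw [h1]
    ring
  simp_rw [h2, h1, integral_cubic]
  ring

theorem BracketTree.I_graft_graft_bullet_zero :
    (BracketTree.graft 0 ![.graft 0 ![.bullet]]).I 0 = 0 := by
  rw [BracketTree.I_graft]
  have h1 : ∀ s : ℝ, ∏ i, (![BracketTree.graft 0 ![BracketTree.bullet]] i).I s
      = 1 / 12 + (-1 / 2) * s + 1 / 2 * s ^ 2 + 0 * s ^ 3 := fun s => by
    simp [BracketTree.I_graft_bullet]
    ring
  have h2 : ∀ s : ℝ, s * ∏ i, (![BracketTree.graft 0 ![BracketTree.bullet]] i).I s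
      = 0 + 1 / 12 * s + (-1 / 2) * s ^ 2 + 1 / 2 * s ^ 3 := fun s => by
    rw [h1]
    ring
  simp_rw [h2, h1, integral_cubic]
  ring

theorem mainTheorem2 :
    (∀ {V : Type*} [Fintype V] [DecidableEq V] (t : RootedTreeOn V),
      -- the angle form is absolutely integrable, so that the weight is well defined
      IntegrableOn t.kontsevichTree.angleFormDensity (configSpace V) ∧
      -- every rooted tree belongs to a topological rooted tree
      (∃ e : BracketTree, Nonempty (t.Iso e.toRootedTree)) ∧
      -- the weight of every representative of the topological rooted tree `e` is `I_e(0)`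
      (∀ e : BracketTree, Nonempty (t.Iso e.toRootedTree) → t.weight = e.I 0)) ∧
    (BracketTree.bullet).toRootedTree.weight = 1 / 2 ∧
    (BracketTree.graft 0 ![.bullet]).toRootedTree.weight = 1 / 12 ∧
    (BracketTree.graft 1 ![.bullet, .bullet]).toRootedTree.weight = 1 / 24 ∧
    (BracketTree.graft 0 ![.graft 0 ![.bullet]]).toRootedTree.weight = 0 := by
  refine ⟨fun {V} _ _ t => ⟨?_, t.exists_iso_bracketTree, ?_⟩, ?_, ?_, ?_, ?_⟩
  · obtain ⟨e, ⟨σ⟩⟩ := t.exists_iso_bracketTree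
    exact (σ.hasAngleIntegral e.hasAngleIntegral).weight_eq.1
  · rintro e ⟨σ⟩
    exact (σ.hasAngleIntegral e.hasAngleIntegral).weight_eq.2
  · rw [BracketTree.weight_eq]
    simp [BracketTree.I]
  · rw [BracketTree.weight_eq, BracketTree.I_graft_bullet]
    norm_num
  · rw [BracketTree.weight_eq, BracketTree.I_graft_bullet_bullet_zero]
  · rw [BracketTree.weight_eq, BracketTree.I_graft_graft_bullet_zero]
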